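/- For $\nu\in\mathbb{R}$ and $x>0$ let $K_\nu(x)=\int_0^\infty e^{-x\cosh t}\cosh(\nu t)\,dt$ denote the modified Bessel function of the second kind. Let $-1<\beta<1$. Then for all $x>0$ the integrals below converge and the following inequalities hold: $$\int_x^\infty t^\nu K_\nu(t)\,dt < x^\nu K_{\nu+1}(x),\qquad \nu\in\mathbb{R},$$ $$\int_x^\infty t^\nu K_\nu(t)\,dt < x^\nu K_\nu(x),\qquad \nu<\tfrac12,$$ $$\int_x^\infty e^{\beta t}t^\nu K_\nu(t)\,dt < \frac{1}{1-|\beta|}\,e^{\beta x}x^\nu K_\nu(x),\qquad \nu<\tfrac12,$$ $$\int_x^\infty t^\nu K_\nu(t)\,dt \le \frac{\sqrt{\pi}\,\Gamma(\nu+\frac12)}{\Gamma(\nu)}\,x^\nu K_\nu(x),\qquad \nu\ge\tfrac12,$$ $$\int_x^\infty e^{\beta t}t^\nu K_\nu(t)\,dt \le \frac{2\sqrt{\pi}\,\Gamma(\nu+\frac12)}{(1-\beta^2)^{\nu+\frac12}\,\Gamma(\nu)}\,e^{\beta x}x^\nu K_\nu(x),\qquad \nu\ge\tfrac12.$$ 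-/

import Mathlib

open MeasureTheory Set

/-- The modified Bessel function of the second kind (Macdonald function) `K_ν(x)`, for real order
`ν` and real argument `x > 0`, given by its absolutely convergent integral representation
`K_ν(x) = ∫_0^∞ exp(-x cosh t) cosh(ν t) dt`. Only its values at `x > 0` are meaningful. -/
noncomputable def besselK (ν x : ℝ) : ℝ :=
  ∫ t in Ioi (0 : ℝ), Real.exp (-x * Real.cosh t) * Real.cosh (ν * t)

/-!
The substitution `u = (x/2) eᵗ` turns the definition of `K_ν` into
`x^ν K_ν(x) = 2^(ν-1) F_ν(x)`, where `F_ν(x) = ∫_0^∞ u^(ν-1) exp(-u - x²/(4u)) du`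
(`rpow_mul_besselK`). Differentiating `F_ν` under the integral sign gives
`(x^ν K_ν)' = -x^ν K_{ν-1}`, and `cosh ≥ 1` gives `K_ν(x) = O(e^{-x})`, so all the integrals
converge.

Integrating `(t^{ν+1} K_{ν+1})' = -t^{ν+1} K_ν` over `(x, ∞)` and using `t > x` gives the bound by
`x^ν K_{ν+1}(x)`. Integrating `(e^{βt} t^ν K_ν)'` and using `K_ν < K_{ν-1}`, which holds for
`ν < 1/2` because then `|ν| < |ν - 1|`, gives the two bounds for `ν < 1/2`.

For `ν ≥ 1/2` the quotient `K_{ν-1} / K_ν` is increasing (`besselK_sub_one_mul_le`), so that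
`x^ν K_ν(x)` is log-concave and `F_ν(x+s) / F_ν(x) ≤ F_ν(s) / F_ν(0)`, with `F_ν(0) = Γ(ν)`
(`Gamma_mul_eulerBessel_add_le`). Multiplying by `e^{βs}` and integrating in `s` reduces the last
two bounds to the integral of `e^{βs} F_ν(s)` over `(0, ∞)`. The integral over the whole line is a
Gaussian followed by a Gamma integral (`integrable_and_integral_exp_mul_eulerBessel`); the half-line
carries at most all of it, and exactly half of it when `β = 0`.
-/

open Filter Topology

/-! ### An Euler-type integral -/

/-- The integral `∫_0^∞ u^(ν-1) exp(-u - x²/(4u)) du`. For `x > 0` it equals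
`2^(1-ν) x^ν K_ν(x)`; for `ν > 0` it is continuous in `x ∈ ℝ`, even, and equals `Γ(ν)` at `0`. -/
noncomputable def eulerBessel (ν x : ℝ) : ℝ :=
  ∫ u in Ioi (0 : ℝ), u ^ (ν - 1) * Real.exp (-u - x ^ 2 / (4 * u))

lemma continuousOn_eulerBessel_integrand (ν x : ℝ) :
    ContinuousOn (fun u : ℝ => u ^ (ν - 1) * Real.exp (-u - x ^ 2 / (4 * u))) (Ioi 0) := by
  intro u hu
  have hu' : (0 : ℝ) < u := hu
  have h1 : ContinuousAt (fun u : ℝ => u ^ (ν - 1)) u :=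
    Real.continuousAt_rpow_const _ _ (Or.inl hu'.ne')
  have h2 : ContinuousAt (fun u : ℝ => Real.exp (-u - x ^ 2 / (4 * u))) u := by
    have : 4 * u ≠ 0 := by positivity
    fun_prop (disch := assumption)
  exact (h1.mul h2).continuousWithinAt

lemma integrableOn_rpow_mul_exp_neg {ν : ℝ} (hν : 0 < ν) :
    IntegrableOn (fun u : ℝ => u ^ (ν - 1) * Real.exp (-u)) (Ioi 0) := by
  simpa only [mul_comm] using Real.GammaIntegral_convergent hν

lemma integrableOn_eulerBessel (ν : ℝ) {x : ℝ} (hx : 0 < x) :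
    IntegrableOn (fun u : ℝ => u ^ (ν - 1) * Real.exp (-u - x ^ 2 / (4 * u))) (Ioi 0) := by
  obtain ⟨k, hk⟩ := exists_nat_gt (-ν)
  -- `exp(-c/u) ≤ k! (u/c)^k` with `c = x²/4` turns the exponent `ν - 1` into `ν + k - 1 > -1`.
  have hint := (integrableOn_rpow_mul_exp_neg (ν := ν + k) (by linarith)).const_mul
    ((k.factorial : ℝ) * (4 / x ^ 2) ^ k)
  refine hint.mono'
    ((continuousOn_eulerBessel_integrand ν x).aestronglyMeasurable measurableSet_Ioi) ?_
  filter_upwards [ae_restrict_mem measurableSet_Ioi] with u hu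
  have hu' : (0 : ℝ) < u := hu
  rw [Real.norm_of_nonneg (by positivity)]
  have h := Real.pow_div_factorial_le_exp (x ^ 2 / (4 * u)) (by positivity) k
  have h2 : Real.exp (-(x ^ 2 / (4 * u))) ≤ k.factorial * (4 / x ^ 2) ^ k * u ^ k := by
    rw [Real.exp_neg]
    refine (inv_anti₀ (by positivity) h).trans_eq ?_
    rw [inv_div, mul_assoc, ← mul_pow, div_eq_mul_inv, ← inv_pow, inv_div, div_mul_eq_mul_div]
  rw [sub_eq_add_neg (-u), Real.exp_add, add_sub_right_comm, Real.rpow_add hu',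
    Real.rpow_natCast]
  calc u ^ (ν - 1) * (Real.exp (-u) * Real.exp (-(x ^ 2 / (4 * u))))
      ≤ u ^ (ν - 1) * (Real.exp (-u) * (k.factorial * (4 / x ^ 2) ^ k * u ^ k)) := by gcongr
    _ = _ := by ring

lemma eulerBessel_zero {ν : ℝ} (hν : 0 < ν) : eulerBessel ν 0 = Real.Gamma ν := by
  rw [eulerBessel, Real.Gamma_eq_integral hν]
  refine integral_congr_ae (.of_forall fun u => ?_)
  simp [mul_comm]

lemma eulerBessel_abs (ν x : ℝ) : eulerBessel ν |x| = eulerBessel ν x := by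
  simp [eulerBessel]

lemma eulerBessel_nonneg (ν x : ℝ) : 0 ≤ eulerBessel ν x :=
  setIntegral_nonneg measurableSet_Ioi fun u hu => by
    have hu' : (0 : ℝ) < u := hu
    positivity

lemma continuous_eulerBessel {ν : ℝ} (hν : 0 < ν) : Continuous (eulerBessel ν) := by
  refine continuous_of_dominated (bound := fun u => u ^ (ν - 1) * Real.exp (-u))
    (fun x => (continuousOn_eulerBessel_integrand ν x).aestronglyMeasurable measurableSet_Ioi)
    (fun x => ?_) (integrableOn_rpow_mul_exp_neg hν) ?_
  · filter_upwards [ae_restrict_mem measurableSet_Ioi] with u hu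
    have hu' : (0 : ℝ) < u := hu
    rw [Real.norm_of_nonneg (by positivity)]
    gcongr
    have : 0 ≤ x ^ 2 / (4 * u) := by positivity
    linarith
  · refine .of_forall fun u => ?_
    fun_prop

lemma hasDerivAt_eulerBessel (ν : ℝ) {x : ℝ} (hx : 0 < x) :
    HasDerivAt (eulerBessel ν) (-(x / 2) * eulerBessel (ν - 1) x) x := by
  have hs : Ioo (x / 2) (2 * x) ∈ 𝓝 x := Ioo_mem_nhds (by linarith) (by linarith)
  have key := (hasDerivAt_integral_of_dominated_loc_of_deriv_le
    (μ := volume.restrict (Ioi (0 : ℝ)))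
    (F := fun y u => u ^ (ν - 1) * Real.exp (-u - y ^ 2 / (4 * u)))
    (F' := fun y u => -(y / 2) * (u ^ (ν - 1 - 1) * Real.exp (-u - y ^ 2 / (4 * u))))
    (bound := fun u => x * (u ^ (ν - 1 - 1) * Real.exp (-u - (x / 2) ^ 2 / (4 * u))))
    hs
    (.of_forall fun y =>
      (continuousOn_eulerBessel_integrand ν y).aestronglyMeasurable measurableSet_Ioi)
    (integrableOn_eulerBessel ν hx)
    (((continuousOn_eulerBessel_integrand (ν - 1) x).const_mul _).aestronglyMeasurable
      measurableSet_Ioi) ?_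
    ((integrableOn_eulerBessel (ν - 1) (half_pos hx)).const_mul x) ?_).2
  · rw [integral_const_mul] at key
    exact key
  · filter_upwards [ae_restrict_mem measurableSet_Ioi] with u hu y hy
    have hu' : (0 : ℝ) < u := hu
    have hy' : 0 < y := (half_pos hx).trans hy.1
    rw [norm_mul, norm_neg, Real.norm_of_nonneg (by positivity : 0 ≤ y / 2),
      Real.norm_of_nonneg (by positivity)]
    have := hy.1
    have := hy.2
    gcongr
    linarith
  · filter_upwards [ae_restrict_mem measurableSet_Ioi] with u hu y _
    have hu' : (0 : ℝ) < u := hu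
    have h : HasDerivAt (fun y : ℝ => -u - y ^ 2 / (4 * u)) (-(2 * y / (4 * u))) y := by
      simpa using ((hasDerivAt_pow 2 y).div_const (4 * u)).const_sub (-u)
    refine (h.exp.const_mul (u ^ (ν - 1))).congr_deriv ?_
    rw [Real.rpow_sub_one hu'.ne' (ν - 1)]
    field_simp
    ring

/-! ### The two integral representations agree -/

/-- The substitution `u = (x/2) eᵗ`, under which `u + x²/(4u) = x cosh t`. -/
lemma eulerBessel_substitution (ν : ℝ) {x : ℝ} (hx : 0 < x) (t : ℝ) :
    |x / 2 * Real.exp t| • ((x / 2 * Real.exp t) ^ (ν - 1) *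
        Real.exp (-(x / 2 * Real.exp t) - x ^ 2 / (4 * (x / 2 * Real.exp t)))) =
      (x / 2) ^ ν * (Real.exp (-x * Real.cosh t) * Real.exp (ν * t)) := by
  have h1 : -(x / 2 * Real.exp t) - x ^ 2 / (4 * (x / 2 * Real.exp t)) = -x * Real.cosh t := by
    rw [Real.cosh_eq, Real.exp_neg]
    field_simp
    ring
  have hpos : 0 < x / 2 * Real.exp t := by positivity
  have h2 : (x / 2 * Real.exp t) * (x / 2 * Real.exp t) ^ (ν - 1) =
      (x / 2) ^ ν * Real.exp (ν * t) := by
    rw [Real.rpow_sub_one hpos.ne', mul_div_cancel₀ _ hpos.ne',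
      Real.mul_rpow (by positivity) (by positivity), ← Real.exp_mul, mul_comm t]
  rw [h1, abs_of_pos hpos, smul_eq_mul, ← mul_assoc, h2]
  ring

lemma image_mul_exp {c : ℝ} (hc : 0 < c) : (fun t : ℝ => c * Real.exp t) '' univ = Ioi 0 := by
  ext u
  simp only [image_univ, mem_range, mem_Ioi]
  constructor
  · rintro ⟨t, rfl⟩
    positivity
  · intro hu
    exact ⟨Real.log (u / c), by rw [Real.exp_log (by positivity)]; field_simp⟩

lemma injOn_mul_exp {c : ℝ} (hc : 0 < c) : InjOn (fun t : ℝ => c * Real.exp t) univ :=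
  fun _ _ _ _ h => Real.exp_injective (mul_left_cancel₀ hc.ne' h)

lemma integrable_exp_cosh_mul_exp (ν : ℝ) {x : ℝ} (hx : 0 < x) :
    Integrable fun t : ℝ => Real.exp (-x * Real.cosh t) * Real.exp (ν * t) := by
  have h := integrableOn_eulerBessel ν hx
  rw [← image_mul_exp (half_pos hx), integrableOn_image_iff_integrableOn_abs_deriv_smul
    MeasurableSet.univ (fun t _ => ((Real.hasDerivAt_exp t).const_mul (x / 2)).hasDerivWithinAt)
    (injOn_mul_exp (half_pos hx)), integrableOn_univ] at h
  simp only [eulerBessel_substitution ν hx] at h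
  have hne : (x / 2) ^ ν ≠ 0 := by positivity
  simpa [hne] using h.const_mul ((x / 2) ^ ν)⁻¹

lemma eulerBessel_eq_integral_exp (ν : ℝ) {x : ℝ} (hx : 0 < x) :
    eulerBessel ν x =
      (x / 2) ^ ν * ∫ t : ℝ, Real.exp (-x * Real.cosh t) * Real.exp (ν * t) := by
  rw [eulerBessel, ← image_mul_exp (half_pos hx), integral_image_eq_integral_abs_deriv_smul
    MeasurableSet.univ (fun t _ => ((Real.hasDerivAt_exp t).const_mul (x / 2)).hasDerivWithinAt)
    (injOn_mul_exp (half_pos hx)), setIntegral_univ]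
  simp only [eulerBessel_substitution ν hx, integral_const_mul]

lemma integrable_exp_cosh_mul_cosh (ν : ℝ) {x : ℝ} (hx : 0 < x) :
    Integrable fun t : ℝ => Real.exp (-x * Real.cosh t) * Real.cosh (ν * t) := by
  refine (((integrable_exp_cosh_mul_exp ν hx).add
    (integrable_exp_cosh_mul_exp (-ν) hx)).div_const 2).congr (.of_forall fun t => ?_)
  simp only [Pi.add_apply, Real.cosh_eq (ν * t), neg_mul]
  ring

lemma integral_exp_cosh_mul_exp (ν : ℝ) {x : ℝ} (hx : 0 < x) :
    ∫ t : ℝ, Real.exp (-x * Real.cosh t) * Real.exp (ν * t) = 2 * besselK ν x := by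
  have h1 : ∫ t : ℝ, Real.exp (-x * Real.cosh t) * Real.exp (-ν * t) =
      ∫ t : ℝ, Real.exp (-x * Real.cosh t) * Real.exp (ν * t) := by
    rw [← integral_neg_eq_self]
    simp
  have h2 : ∫ t : ℝ, Real.exp (-x * Real.cosh t) * Real.cosh (ν * t) = 2 * besselK ν x := by
    rw [besselK, ← integral_comp_abs]
    congr 1 with t
    rw [Real.cosh_abs, ← Real.cosh_abs (ν * |t|), abs_mul, abs_abs, ← abs_mul, Real.cosh_abs]
  rw [← h2]
  have h3 := integral_add (integrable_exp_cosh_mul_exp ν hx) (integrable_exp_cosh_mul_exp (-ν) hx)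
  rw [h1] at h3
  have h4 : ∫ t : ℝ, Real.exp (-x * Real.cosh t) * Real.cosh (ν * t) =
      (∫ t : ℝ, (Real.exp (-x * Real.cosh t) * Real.exp (ν * t) +
        Real.exp (-x * Real.cosh t) * Real.exp (-ν * t))) / 2 := by
    rw [← integral_div]
    congr 1 with t
    simp only [Real.cosh_eq (ν * t), neg_mul]
    ring
  rw [h4, h3]
  ring

lemma rpow_mul_besselK (ν : ℝ) {x : ℝ} (hx : 0 < x) :
    x ^ ν * besselK ν x = 2 ^ (ν - 1) * eulerBessel ν x := by
  rw [eulerBessel_eq_integral_exp ν hx, integral_exp_cosh_mul_exp ν hx,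
    Real.div_rpow hx.le zero_le_two, Real.rpow_sub_one two_ne_zero]
  field_simp

/-! ### Elementary properties of `K_ν` -/

lemma integrableOn_besselK_integrand (ν : ℝ) {x : ℝ} (hx : 0 < x) :
    IntegrableOn (fun t : ℝ => Real.exp (-x * Real.cosh t) * Real.cosh (ν * t)) (Ioi 0) :=
  (integrable_exp_cosh_mul_cosh ν hx).integrableOn

lemma setIntegral_lt_of_forall_lt {f g : ℝ → ℝ} {a : ℝ} (hf : IntegrableOn f (Ioi a))
    (hg : IntegrableOn g (Ioi a)) (h : ∀ t ∈ Ioi a, f t < g t) :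
    ∫ t in Ioi a, f t < ∫ t in Ioi a, g t := by
  rw [← sub_pos, ← integral_sub hg hf]
  refine (setIntegral_pos_iff_support_of_nonneg_ae ?_ (hg.sub hf)).2 ?_
  · filter_upwards [ae_restrict_mem measurableSet_Ioi] with t ht
    exact (sub_pos.2 (h t ht)).le
  · have : Function.support (g - f) ∩ Ioi a = Ioi a :=
      inter_eq_right.2 fun t ht => (sub_pos.2 (h t ht)).ne'
    rw [this]
    simp

lemma besselK_pos (ν : ℝ) {x : ℝ} (hx : 0 < x) : 0 < besselK ν x := by
  have := setIntegral_lt_of_forall_lt (integrableOn_zero (μ := volume) (s := Ioi (0 : ℝ)))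
    (integrableOn_besselK_integrand ν hx)
    (fun t _ => mul_pos (Real.exp_pos _) (Real.cosh_pos _))
  simpa [besselK] using this

lemma besselK_lt_of_abs_lt {ν μ : ℝ} (h : |ν| < |μ|) {x : ℝ} (hx : 0 < x) :
    besselK ν x < besselK μ x := by
  refine setIntegral_lt_of_forall_lt (integrableOn_besselK_integrand ν hx)
    (integrableOn_besselK_integrand μ hx) fun t ht => ?_
  have ht' : (0 : ℝ) < t := ht
  refine mul_lt_mul_of_pos_left (Real.cosh_lt_cosh.2 ?_) (Real.exp_pos _)
  rw [abs_mul, abs_mul]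
  exact mul_lt_mul_of_pos_right h (by positivity)

/-- Exponential decay, from `cosh ≥ 1` in the integral representation. -/
lemma besselK_le_exp_mul (ν : ℝ) {x y : ℝ} (hx : 0 < x) (hxy : x ≤ y) :
    besselK ν y ≤ Real.exp (-(y - x)) * besselK ν x := by
  rw [besselK, besselK, ← integral_const_mul]
  refine setIntegral_mono (integrableOn_besselK_integrand ν (hx.trans_le hxy))
    ((integrableOn_besselK_integrand ν hx).const_mul _) fun t => ?_
  rw [← mul_assoc, ← Real.exp_add]
  gcongr
  nlinarith [Real.one_le_cosh t]

lemma hasDerivAt_rpow_mul_besselK (ν : ℝ) {x : ℝ} (hx : 0 < x) :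
    HasDerivAt (fun y => y ^ ν * besselK ν y) (-(x ^ ν * besselK (ν - 1) x)) x := by
  have h : x ^ ν * besselK (ν - 1) x = x * (2 ^ (ν - 1 - 1) * eulerBessel (ν - 1) x) := by
    rw [← rpow_mul_besselK _ hx, Real.rpow_sub_one hx.ne']
    field_simp
  refine (((hasDerivAt_eulerBessel ν hx).const_mul (2 ^ (ν - 1))).congr_of_eventuallyEq
    ?_).congr_deriv ?_
  · filter_upwards [lt_mem_nhds hx] with y hy using rpow_mul_besselK ν hy
  · rw [h, Real.rpow_sub_one two_ne_zero (ν - 1)]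
    ring

lemma continuousOn_besselK (ν : ℝ) : ContinuousOn (besselK ν) (Ioi 0) := by
  have h : ContinuousOn (fun y : ℝ => y ^ (-ν) * (y ^ ν * besselK ν y)) (Ioi 0) := by
    intro y hy
    exact ((Real.continuousAt_rpow_const y (-ν) (Or.inl (ne_of_gt hy))).mul
      (hasDerivAt_rpow_mul_besselK ν hy).continuousAt).continuousWithinAt
  refine h.congr fun y hy => ?_
  have hy' : (0 : ℝ) < y := hy
  simp only
  rw [← mul_assoc, ← Real.rpow_add hy', neg_add_cancel, Real.rpow_zero, one_mul]

/-! ### Integrals over a half-line away from the origin -/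

lemma isBigO_exp_mul_rpow_mul_besselK {β : ℝ} (hβ : β < 1) (a ν : ℝ) :
    (fun t : ℝ => Real.exp (β * t) * t ^ a * besselK ν t) =O[atTop]
      fun t => Real.exp (-((1 - β) / 2) * t) := by
  have h1 : (besselK ν) =O[atTop] fun t : ℝ => Real.exp (-t) := by
    refine Asymptotics.IsBigO.of_bound (Real.exp 1 * besselK ν 1) ?_
    filter_upwards [eventually_ge_atTop 1] with t ht
    rw [Real.norm_of_nonneg (besselK_pos ν (by linarith)).le,
      Real.norm_of_nonneg (Real.exp_pos _).le]
    refine (besselK_le_exp_mul ν one_pos ht).trans_eq ?_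
    rw [neg_sub, Real.exp_sub, Real.exp_neg]
    field_simp
  have h2 := (isLittleO_rpow_exp_pos_mul_atTop a
    (b := (1 - β) / 2) (by linarith)).isBigO
  refine (((Asymptotics.isBigO_refl (fun t : ℝ => Real.exp (β * t)) atTop).mul h2).mul
    h1).congr_right fun t => ?_
  rw [← Real.exp_add, ← Real.exp_add]
  ring_nf

lemma integrableOn_exp_mul_rpow_mul_besselK {β : ℝ} (hβ : β < 1) (a ν : ℝ) {x : ℝ}
    (hx : 0 < x) : IntegrableOn (fun t : ℝ => Real.exp (β * t) * t ^ a * besselK ν t) (Ioi x) := by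
  refine integrable_of_isBigO_exp_neg (b := (1 - β) / 2) (by linarith) ?_
    (isBigO_exp_mul_rpow_mul_besselK hβ a ν)
  have hsub : Ici x ⊆ Ioi 0 := fun y hy => hx.trans_le hy
  refine ContinuousOn.mul (ContinuousOn.mul (by fun_prop) ?_) ((continuousOn_besselK ν).mono hsub)
  exact fun y hy => (Real.continuousAt_rpow_const y a
    (Or.inl (hsub hy : (0 : ℝ) < y).ne')).continuousWithinAt

lemma tendsto_exp_mul_rpow_mul_besselK {β : ℝ} (hβ : β < 1) (a ν : ℝ) :
    Tendsto (fun t : ℝ => Real.exp (β * t) * t ^ a * besselK ν t) atTop (𝓝 0) := by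
  refine (isBigO_exp_mul_rpow_mul_besselK hβ a ν).trans_tendsto ?_
  refine Real.tendsto_exp_atBot.comp (tendsto_id.const_mul_atTop_of_neg ?_)
  linarith

/-- Integration of `d/dt (e^{βt} t^ν K_ν(t)) = β e^{βt} t^ν K_ν(t) - e^{βt} t^ν K_{ν-1}(t)`. -/
lemma integral_exp_mul_rpow_mul_besselK_sub_one {β : ℝ} (hβ : β < 1) (ν : ℝ) {x : ℝ}
    (hx : 0 < x) :
    ∫ t in Ioi x, Real.exp (β * t) * t ^ ν * besselK (ν - 1) t =
      Real.exp (β * x) * x ^ ν * besselK ν x +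
        β * ∫ t in Ioi x, Real.exp (β * t) * t ^ ν * besselK ν t := by
  have hi := (integrableOn_exp_mul_rpow_mul_besselK hβ ν ν hx).const_mul β
  have hi' := integrableOn_exp_mul_rpow_mul_besselK hβ ν (ν - 1) hx
  have h := integral_Ioi_of_hasDerivAt_of_tendsto'
    (f := fun t : ℝ => Real.exp (β * t) * t ^ ν * besselK ν t)
    (f' := fun t => β * (Real.exp (β * t) * t ^ ν * besselK ν t) -
      Real.exp (β * t) * t ^ ν * besselK (ν - 1) t) (a := x) (m := 0) ?_ (hi.sub hi')
      (tendsto_exp_mul_rpow_mul_besselK hβ ν ν)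
  · rw [integral_sub hi hi', integral_const_mul] at h
    linarith
  · intro t ht
    have ht' : 0 < t := hx.trans_le ht
    have he : HasDerivAt (fun t : ℝ => Real.exp (β * t)) (Real.exp (β * t) * β) t := by
      simpa using ((hasDerivAt_id t).const_mul β).exp
    have := he.mul (hasDerivAt_rpow_mul_besselK ν ht')
    simp only [mul_assoc]
    refine this.congr_deriv ?_
    ring

lemma integral_rpow_mul_besselK_lt_succ (ν : ℝ) {x : ℝ} (hx : 0 < x) :
    ∫ t in Ioi x, t ^ ν * besselK ν t < x ^ ν * besselK (ν + 1) x := by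
  have h := integral_exp_mul_rpow_mul_besselK_sub_one (β := 0) zero_lt_one (ν + 1) hx
  have hi := integrableOn_exp_mul_rpow_mul_besselK (β := 0) zero_lt_one ν ν hx
  have hi' := integrableOn_exp_mul_rpow_mul_besselK (β := 0) zero_lt_one (ν + 1) ν hx
  simp only [zero_mul, Real.exp_zero, one_mul, add_zero, add_sub_cancel_right] at h hi hi'
  have hlt := setIntegral_lt_of_forall_lt (hi.const_mul x) hi' fun t ht => by
    have hxt : x < t := ht
    have ht' : 0 < t := hx.trans hxt
    rw [Real.rpow_add_one ht'.ne', mul_comm (t ^ ν) t, mul_assoc]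
    exact mul_lt_mul_of_pos_right hxt (mul_pos (by positivity) (besselK_pos ν ht'))
  rw [integral_const_mul, h, Real.rpow_add_one hx.ne', mul_comm (x ^ ν) x, mul_assoc] at hlt
  exact lt_of_mul_lt_mul_left hlt hx.le

lemma integral_exp_mul_rpow_mul_besselK_lt {β : ℝ} (hβ₁ : -1 < β) (hβ₂ : β < 1) {ν : ℝ}
    (hν : ν < 1 / 2) {x : ℝ} (hx : 0 < x) :
    ∫ t in Ioi x, Real.exp (β * t) * t ^ ν * besselK ν t <
      1 / (1 - |β|) * (Real.exp (β * x) * x ^ ν * besselK ν x) := by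
  have hlt := setIntegral_lt_of_forall_lt
    (integrableOn_exp_mul_rpow_mul_besselK hβ₂ ν ν hx)
    (integrableOn_exp_mul_rpow_mul_besselK hβ₂ ν (ν - 1) hx) fun t ht => by
      have ht' : 0 < t := hx.trans ht
      refine mul_lt_mul_of_pos_left (besselK_lt_of_abs_lt ?_ ht') (by positivity)
      rw [← sq_lt_sq]
      nlinarith
  rw [integral_exp_mul_rpow_mul_besselK_sub_one hβ₂ ν hx] at hlt
  have hpos : 0 ≤ ∫ t in Ioi x, Real.exp (β * t) * t ^ ν * besselK ν t :=
    setIntegral_nonneg measurableSet_Ioi fun t ht => by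
      have ht' : 0 < t := hx.trans ht
      have := besselK_pos ν ht'
      positivity
  have hβ : 0 < 1 - |β| := sub_pos.2 (abs_lt.2 ⟨hβ₁, hβ₂⟩)
  rw [one_div, lt_inv_mul_iff₀ hβ]
  nlinarith [mul_le_mul_of_nonneg_right (le_abs_self β) hpos]

/-! ### Log-concavity of `x ^ ν * K_ν(x)` for `ν ≥ 1/2` -/

/-- For `ν ≥ 1/2`, `cosh((ν-1)s) / cosh(νs)` decreases in `s ≥ 0`. -/
lemma cosh_mul_cosh_le {ν : ℝ} (hν : 1 / 2 ≤ ν) {s t : ℝ} (ht : 0 ≤ t) (hst : t ≤ s) :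
    Real.cosh ((ν - 1) * s) * Real.cosh (ν * t) ≤
      Real.cosh ((ν - 1) * t) * Real.cosh (ν * s) := by
  have hprod : ∀ a b : ℝ, Real.cosh a * Real.cosh b =
      (Real.cosh (a + b) + Real.cosh (a - b)) / 2 := fun a b => by
    rw [Real.cosh_add, Real.cosh_sub]
    ring
  rw [hprod, hprod]
  have h1 : Real.cosh ((ν - 1) * s + ν * t) ≤ Real.cosh ((ν - 1) * t + ν * s) := by
    rw [Real.cosh_le_cosh, ← sq_le_sq]
    nlinarith [mul_nonneg (mul_nonneg (sub_nonneg.2 hst) (add_nonneg ht (ht.trans hst)))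
      (sub_nonneg.2 hν)]
  have h2 : Real.cosh ((ν - 1) * s - ν * t) ≤ Real.cosh ((ν - 1) * t - ν * s) := by
    rw [Real.cosh_le_cosh, ← sq_le_sq]
    nlinarith [mul_nonneg (mul_nonneg (sub_nonneg.2 hst) (add_nonneg ht (ht.trans hst)))
      (sub_nonneg.2 hν)]
  linarith

/-- The quotient `K_{ν-1} / K_ν` is increasing for `ν ≥ 1/2`, by Chebyshev's correlation argument:
both `cosh((ν-1)s) / cosh(νs)` and `exp(-(y-x) cosh s)` decrease in `s`. -/
lemma besselK_sub_one_mul_le {ν : ℝ} (hν : 1 / 2 ≤ ν) {x y : ℝ} (hx : 0 < x) (hxy : x ≤ y) :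
    besselK (ν - 1) x * besselK ν y ≤ besselK (ν - 1) y * besselK ν x := by
  have hy : 0 < y := hx.trans_le hxy
  set w : ℝ → ℝ → ℝ → ℝ := fun z μ t => Real.exp (-z * Real.cosh t) * Real.cosh (μ * t) with hw
  set m := volume.restrict (Ioi (0 : ℝ)) with hm
  have hwi : ∀ z, 0 < z → ∀ μ, Integrable (w z μ) m := fun z hz μ =>
    integrableOn_besselK_integrand μ hz
  have hK : ∀ z μ, ∫ t, w z μ t ∂m = besselK μ z := fun z μ => rfl
  have i1 := (hwi x hx (ν - 1)).mul_prod (hwi y hy ν)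
  have i2 := (hwi y hy ν).mul_prod (hwi x hx (ν - 1))
  have i3 := (hwi y hy (ν - 1)).mul_prod (hwi x hx ν)
  have i4 := (hwi x hx ν).mul_prod (hwi y hy (ν - 1))
  have hle : ∫ p, (w x (ν - 1) p.1 * w y ν p.2 + w y ν p.1 * w x (ν - 1) p.2) ∂(m.prod m) ≤
      ∫ p, (w y (ν - 1) p.1 * w x ν p.2 + w x ν p.1 * w y (ν - 1) p.2) ∂(m.prod m) := by
    refine integral_mono_ae (i1.add i2) (i3.add i4) ?_
    rw [hm, Measure.prod_restrict]
    filter_upwards [ae_restrict_mem (measurableSet_Ioi.prod measurableSet_Ioi)] with p hp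
    obtain ⟨s, t⟩ := p
    obtain ⟨hs, ht⟩ := hp
    have hs : 0 < s := hs
    have ht : 0 < t := ht
    simp only [hw]
    have hsign : 0 ≤ (Real.exp (-x * Real.cosh s) * Real.exp (-y * Real.cosh t) -
        Real.exp (-y * Real.cosh s) * Real.exp (-x * Real.cosh t)) *
        (Real.cosh ((ν - 1) * t) * Real.cosh (ν * s) -
          Real.cosh ((ν - 1) * s) * Real.cosh (ν * t)) := by
      rw [← Real.exp_add, ← Real.exp_add]
      rcases le_total t s with hts | hts
      · have hc : Real.cosh t ≤ Real.cosh s := by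
          rwa [Real.cosh_le_cosh, abs_of_pos hs, abs_of_pos ht]
        refine mul_nonneg (sub_nonneg.2 (Real.exp_le_exp.2 ?_))
          (sub_nonneg.2 (cosh_mul_cosh_le hν ht.le hts))
        nlinarith
      · have hc : Real.cosh s ≤ Real.cosh t := by
          rwa [Real.cosh_le_cosh, abs_of_pos hs, abs_of_pos ht]
        refine mul_nonneg_of_nonpos_of_nonpos (sub_nonpos.2 (Real.exp_le_exp.2 ?_))
          (sub_nonpos.2 (cosh_mul_cosh_le hν hs.le hts))
        nlinarith
    rw [← sub_nonneg]
    refine hsign.trans_eq ?_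
    ring
  rw [integral_add i1 i2, integral_add i3 i4, integral_prod_mul, integral_prod_mul,
    integral_prod_mul, integral_prod_mul] at hle
  simp only [hK] at hle
  linarith

lemma eulerBessel_pos (ν : ℝ) {x : ℝ} (hx : 0 < x) : 0 < eulerBessel ν x := by
  have h := mul_pos (Real.rpow_pos_of_pos hx ν) (besselK_pos ν hx)
  rw [rpow_mul_besselK ν hx] at h
  exact pos_of_mul_pos_right h (by positivity)

/-- For `ν ≥ 1/2` and `s > 0` the quotient `F(y + s) / F(y)` of `F(y) = y^ν K_ν(y)`
decreases in `y > 0`. -/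
lemma antitoneOn_rpow_mul_besselK_shift_div {ν : ℝ} (hν : 1 / 2 ≤ ν) {s : ℝ} (hs : 0 < s) :
    AntitoneOn (fun y : ℝ => ((y + s) ^ ν * besselK ν (y + s)) / (y ^ ν * besselK ν y))
      (Ioi 0) := by
  have hd : ∀ y : ℝ, 0 < y → HasDerivAt
      (fun y : ℝ => ((y + s) ^ ν * besselK ν (y + s)) / (y ^ ν * besselK ν y))
      ((-((y + s) ^ ν * besselK (ν - 1) (y + s)) * (y ^ ν * besselK ν y) -
        (y + s) ^ ν * besselK ν (y + s) * -(y ^ ν * besselK (ν - 1) y)) /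
          (y ^ ν * besselK ν y) ^ 2) y := by
    intro y hy
    have hne : y ^ ν * besselK ν y ≠ 0 := (mul_pos (by positivity) (besselK_pos ν hy)).ne'
    exact ((hasDerivAt_rpow_mul_besselK ν (add_pos hy hs)).comp_add_const y s).div
      (hasDerivAt_rpow_mul_besselK ν hy) hne
  refine antitoneOn_of_deriv_nonpos (convex_Ioi 0)
    (fun y hy => (hd y hy).continuousAt.continuousWithinAt) ?_ ?_
  · rw [interior_Ioi]
    exact fun y hy => (hd y hy).differentiableAt.differentiableWithinAt
  · rw [interior_Ioi]
    intro y hy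
    have hy' : 0 < y := hy
    rw [(hd y hy').deriv]
    refine div_nonpos_of_nonpos_of_nonneg ?_ (sq_nonneg _)
    have h := mul_le_mul_of_nonneg_left (besselK_sub_one_mul_le hν hy' (by linarith : y ≤ y + s))
      (by positivity : 0 ≤ (y + s) ^ ν * y ^ ν)
    linarith

/-- Compare the quotient `eulerBessel ν (y + s) / eulerBessel ν y` at `y = x` with its limit as
`y → 0`, where the denominator tends to `Γ(ν)`. -/
lemma Gamma_mul_eulerBessel_add_le {ν : ℝ} (hν : 1 / 2 ≤ ν) {x s : ℝ} (hx : 0 < x)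
    (hs : 0 < s) :
    Real.Gamma ν * eulerBessel ν (x + s) ≤ eulerBessel ν x * eulerBessel ν s := by
  have hν0 : 0 < ν := by linarith
  have hcont := continuous_eulerBessel hν0
  have h1 : Tendsto (fun y => eulerBessel ν y * eulerBessel ν (x + s)) (𝓝[>] 0)
      (𝓝 (Real.Gamma ν * eulerBessel ν (x + s))) := by
    rw [← eulerBessel_zero hν0]
    exact (((hcont.tendsto 0).mul_const _)).mono_left nhdsWithin_le_nhds
  have h2 : Tendsto (fun y => eulerBessel ν x * eulerBessel ν (y + s)) (𝓝[>] 0)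
      (𝓝 (eulerBessel ν x * eulerBessel ν s)) := by
    have : Continuous fun y => eulerBessel ν x * eulerBessel ν (y + s) := by fun_prop
    simpa using (this.tendsto 0).mono_left nhdsWithin_le_nhds
  refine le_of_tendsto_of_tendsto h1 h2 ?_
  filter_upwards [Ioo_mem_nhdsGT hx] with y hy
  have hy' : 0 < y := hy.1
  have h := antitoneOn_rpow_mul_besselK_shift_div hν hs hy' hx hy.2.le
  simp only [rpow_mul_besselK ν (add_pos hx hs), rpow_mul_besselK ν (add_pos hy' hs),
    rpow_mul_besselK ν hx, rpow_mul_besselK ν hy'] at h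
  have h2 : (2 : ℝ) ^ (ν - 1) ≠ 0 := by positivity
  rw [mul_div_mul_left _ _ h2, mul_div_mul_left _ _ h2,
    div_le_div_iff₀ (eulerBessel_pos ν hx) (eulerBessel_pos ν hy')] at h
  linarith

/-! ### The two-sided Laplace transform -/

lemma exp_mul_sub_sq_div {u : ℝ} (hu : 0 < u) (β x : ℝ) :
    Real.exp (β * x) * Real.exp (-u - x ^ 2 / (4 * u)) =
      Real.exp (-((1 - β ^ 2) * u)) * Real.exp (-(1 / (4 * u)) * (x - 2 * β * u) ^ 2) := by
  rw [← Real.exp_add, ← Real.exp_add]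
  congr 1
  field_simp
  ring

lemma integrable_exp_mul_gaussian {u : ℝ} (hu : 0 < u) (β : ℝ) :
    Integrable fun x : ℝ => Real.exp (β * x) * Real.exp (-u - x ^ 2 / (4 * u)) := by
  simp only [exp_mul_sub_sq_div hu]
  exact ((integrable_exp_neg_mul_sq (by positivity : 0 < 1 / (4 * u))).comp_sub_right
    (2 * β * u)).const_mul _

lemma integral_exp_mul_gaussian {u : ℝ} (hu : 0 < u) (β : ℝ) :
    ∫ x : ℝ, Real.exp (β * x) * Real.exp (-u - x ^ 2 / (4 * u)) =
      2 * √Real.pi * (u ^ (1 / 2 : ℝ) * Real.exp (-((1 - β ^ 2) * u))) := by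
  simp only [exp_mul_sub_sq_div hu]
  rw [integral_const_mul,
    integral_sub_right_eq_self (fun x : ℝ => Real.exp (-(1 / (4 * u)) * x ^ 2)),
    integral_gaussian, ← Real.sqrt_eq_rpow]
  have : Real.pi / (1 / (4 * u)) = 2 ^ 2 * (Real.pi * u) := by field_simp; norm_num
  rw [this, Real.sqrt_mul (by positivity), Real.sqrt_sq zero_le_two,
    Real.sqrt_mul Real.pi_pos.le]
  ring

lemma integrableOn_rpow_mul_exp_neg_mul {ν c : ℝ} (hν : 0 < ν) (hc : 0 < c) :
    IntegrableOn (fun u : ℝ => u ^ (ν - 1) * Real.exp (-(c * u))) (Ioi 0) := by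
  have := integrableOn_rpow_mul_exp_neg_mul_rpow (s := ν - 1) (p := 1) (by linarith) one_pos hc
  simpa using this

/-- Fubini reduces the Laplace transform to Gaussian integrals followed by a Gamma integral. -/
lemma integrable_and_integral_exp_mul_eulerBessel {ν β : ℝ} (hν : 0 < ν) (hβ : β ^ 2 < 1) :
    Integrable (fun x : ℝ => Real.exp (β * x) * eulerBessel ν x) ∧
    ∫ x : ℝ, Real.exp (β * x) * eulerBessel ν x =
      2 * √Real.pi * Real.Gamma (ν + 1 / 2) / (1 - β ^ 2) ^ (ν + 1 / 2) := by
  set m := volume.restrict (Ioi (0 : ℝ)) with hm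
  set f : ℝ → ℝ → ℝ := fun x u =>
    u ^ (ν - 1) * (Real.exp (β * x) * Real.exp (-u - x ^ 2 / (4 * u))) with hf
  have hc : 0 < 1 - β ^ 2 := by linarith
  have hinner : ∀ u ∈ Ioi (0 : ℝ), ∫ x, f x u = 2 * √Real.pi *
      (u ^ (ν + 1 / 2 - 1) * Real.exp (-((1 - β ^ 2) * u))) := fun u hu => by
    simp only [hf]
    rw [integral_const_mul, integral_exp_mul_gaussian hu,
      show ν + 1 / 2 - 1 = (ν - 1) + 1 / 2 by ring, Real.rpow_add hu]
    ring
  have hmeas : AEStronglyMeasurable (Function.uncurry f) (volume.prod m) := by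
    refine Measurable.aestronglyMeasurable ?_
    simp only [hf, Function.uncurry_def]
    fun_prop
  have hprod : Integrable (Function.uncurry f) (volume.prod m) := by
    refine (integrable_prod_iff' hmeas).2 ⟨?_, ?_⟩
    · filter_upwards [ae_restrict_mem measurableSet_Ioi] with u hu
      exact (integrable_exp_mul_gaussian hu β).const_mul (u ^ (ν - 1))
    · refine ((integrableOn_rpow_mul_exp_neg_mul (ν := ν + 1 / 2) (by linarith) hc).const_mul
        (2 * √Real.pi)).congr ?_
      filter_upwards [ae_restrict_mem measurableSet_Ioi] with u hu
      have hu' : (0 : ℝ) < u := hu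
      rw [← hinner u hu]
      congr 1 with x
      exact (Real.norm_of_nonneg (by simp only [hf]; positivity)).symm
  have hleft : ∀ x, ∫ u, f x u ∂m = Real.exp (β * x) * eulerBessel ν x := fun x => by
    rw [eulerBessel, ← integral_const_mul]
    congr 1 with u
    simp only [hf]
    ring
  constructor
  · exact hprod.integral_prod_left.congr (.of_forall hleft)
  · simp only [← hleft]
    rw [integral_integral_swap hprod, setIntegral_congr_fun measurableSet_Ioi hinner,
      integral_const_mul, Real.integral_rpow_mul_exp_neg_mul_Ioi (by linarith) hc,
      Real.div_rpow zero_le_one hc.le, Real.one_rpow]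
    ring

/-! ### Bounds for `ν ≥ 1/2` -/

lemma Gamma_mul_integral_exp_mul_rpow_mul_besselK_le {ν β : ℝ} (hν : 1 / 2 ≤ ν)
    (hβ : β ^ 2 < 1) {x : ℝ} (hx : 0 < x) :
    Real.Gamma ν * ∫ t in Ioi x, Real.exp (β * t) * t ^ ν * besselK ν t ≤
      (Real.exp (β * x) * x ^ ν * besselK ν x) *
        ∫ s in Ioi (0 : ℝ), Real.exp (β * s) * eulerBessel ν s := by
  have hi := (integrable_and_integral_exp_mul_eulerBessel (ν := ν) (by linarith) hβ).1
  have hK : ∀ t, 0 < t → Real.exp (β * t) * t ^ ν * besselK ν t =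
      2 ^ (ν - 1) * (Real.exp (β * t) * eulerBessel ν t) := fun t ht => by
    rw [mul_assoc, rpow_mul_besselK ν ht]
    ring
  have hshift : ∫ t in Ioi x, Real.exp (β * t) * eulerBessel ν t =
      ∫ s in Ioi (0 : ℝ), Real.exp (β * (x + s)) * eulerBessel ν (x + s) := by
    have h := (measurePreserving_add_left volume x).setIntegral_preimage_emb
      (measurableEmbedding_addLeft x) (fun t => Real.exp (β * t) * eulerBessel ν t) (Ioi x)
    simpa using h.symm
  rw [setIntegral_congr_fun measurableSet_Ioi fun t ht => hK t (hx.trans ht), hK x hx,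
    integral_const_mul, hshift, mul_left_comm, mul_assoc]
  refine mul_le_mul_of_nonneg_left ?_ (by positivity)
  rw [← integral_const_mul, ← integral_const_mul]
  refine setIntegral_mono_on ?_ (hi.integrableOn.const_mul _) measurableSet_Ioi fun s hs => ?_
  · exact ((hi.comp_add_left x).const_mul _).integrableOn
  · rw [mul_add β, Real.exp_add]
    have := mul_le_mul_of_nonneg_left (Gamma_mul_eulerBessel_add_le hν hx hs)
      (mul_pos (Real.exp_pos (β * x)) (Real.exp_pos (β * s))).le
    linarith

lemma integral_exp_mul_rpow_mul_besselK_le {ν β : ℝ} (hν : 1 / 2 ≤ ν)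
    (hβ : β ^ 2 < 1) {x : ℝ} (hx : 0 < x) :
    ∫ t in Ioi x, Real.exp (β * t) * t ^ ν * besselK ν t ≤
      2 * √Real.pi * Real.Gamma (ν + 1 / 2) / ((1 - β ^ 2) ^ (ν + 1 / 2) * Real.Gamma ν) *
        (Real.exp (β * x) * x ^ ν * besselK ν x) := by
  obtain ⟨hi, hval⟩ := integrable_and_integral_exp_mul_eulerBessel (ν := ν) (by linarith) hβ
  have hΓ : 0 < Real.Gamma ν := Real.Gamma_pos_of_pos (by linarith)
  have hc : 0 < 1 - β ^ 2 := by linarith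
  have hle : ∫ s in Ioi (0 : ℝ), Real.exp (β * s) * eulerBessel ν s ≤
      2 * √Real.pi * Real.Gamma (ν + 1 / 2) / (1 - β ^ 2) ^ (ν + 1 / 2) :=
    hval ▸ setIntegral_le_integral hi
      (.of_forall fun s => mul_nonneg (Real.exp_pos _).le (eulerBessel_nonneg ν s))
  have hKx := besselK_pos ν hx
  rw [← mul_le_mul_iff_right₀ hΓ]
  refine (Gamma_mul_integral_exp_mul_rpow_mul_besselK_le hν hβ hx).trans
    ((mul_le_mul_of_nonneg_left hle (by positivity)).trans_eq ?_)
  field_simp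

lemma integral_rpow_mul_besselK_le {ν : ℝ} (hν : 1 / 2 ≤ ν) {x : ℝ} (hx : 0 < x) :
    ∫ t in Ioi x, t ^ ν * besselK ν t ≤
      √Real.pi * Real.Gamma (ν + 1 / 2) / Real.Gamma ν * (x ^ ν * besselK ν x) := by
  have hval := (integrable_and_integral_exp_mul_eulerBessel (ν := ν) (β := 0) (by linarith)
    (by norm_num)).2
  have hΓ : 0 < Real.Gamma ν := Real.Gamma_pos_of_pos (by linarith)
  have h := Gamma_mul_integral_exp_mul_rpow_mul_besselK_le hν (β := 0) (by norm_num) hx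
  have habs := integral_comp_abs (f := eulerBessel ν)
  simp only [eulerBessel_abs] at habs
  simp only [zero_mul, Real.exp_zero, one_mul, ne_eq, OfNat.ofNat_ne_zero, not_false_eq_true,
    zero_pow, sub_zero, Real.one_rpow, div_one] at hval h
  have hhalf : ∫ s in Ioi (0 : ℝ), eulerBessel ν s = √Real.pi * Real.Gamma (ν + 1 / 2) := by
    linarith
  rw [hhalf] at h
  rw [← mul_le_mul_iff_right₀ hΓ]
  refine h.trans_eq ?_
  field_simp

theorem theorem2p5 (β : ℝ) (hβ₁ : -1 < β) (hβ₂ : β < 1) (x : ℝ) (hx : 0 < x) :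
    -- all the integrals below converge
    (∀ ν : ℝ, IntegrableOn (fun t : ℝ => t ^ ν * besselK ν t) (Ioi x)) ∧
    (∀ ν : ℝ, IntegrableOn (fun t : ℝ => Real.exp (β * t) * t ^ ν * besselK ν t) (Ioi x)) ∧
    -- the bounds
    (∀ ν : ℝ, (∫ t in Ioi x, t ^ ν * besselK ν t) < x ^ ν * besselK (ν + 1) x) ∧
    (∀ ν : ℝ, ν < 1 / 2 → (∫ t in Ioi x, t ^ ν * besselK ν t) < x ^ ν * besselK ν x) ∧
    (∀ ν : ℝ, ν < 1 / 2 →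
      (∫ t in Ioi x, Real.exp (β * t) * t ^ ν * besselK ν t)
        < 1 / (1 - |β|) * (Real.exp (β * x) * x ^ ν * besselK ν x)) ∧
    (∀ ν : ℝ, 1 / 2 ≤ ν →
      (∫ t in Ioi x, t ^ ν * besselK ν t)
        ≤ √Real.pi * Real.Gamma (ν + 1 / 2) / Real.Gamma ν * (x ^ ν * besselK ν x)) ∧
    (∀ ν : ℝ, 1 / 2 ≤ ν →
      (∫ t in Ioi x, Real.exp (β * t) * t ^ ν * besselK ν t)
        ≤ 2 * √Real.pi * Real.Gamma (ν + 1 / 2)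
            / ((1 - β ^ 2) ^ (ν + 1 / 2) * Real.Gamma ν)
          * (Real.exp (β * x) * x ^ ν * besselK ν x)) := by
  have hβ : β ^ 2 < 1 := by nlinarith
  refine ⟨fun ν => ?_, fun ν => integrableOn_exp_mul_rpow_mul_besselK hβ₂ ν ν hx,
    fun ν => integral_rpow_mul_besselK_lt_succ ν hx, fun ν hν => ?_,
    fun ν hν => integral_exp_mul_rpow_mul_besselK_lt hβ₁ hβ₂ hν hx,
    fun ν hν => integral_rpow_mul_besselK_le hν hx,
    fun ν hν => integral_exp_mul_rpow_mul_besselK_le hν hβ hx⟩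
  · simpa using integrableOn_exp_mul_rpow_mul_besselK (β := 0) zero_lt_one ν ν hx
  · simpa using integral_exp_mul_rpow_mul_besselK_lt (β := 0) (by norm_num) zero_lt_one hν hx
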